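/- Let $F$ be an algebraically closed field of characteristic $p>0$, let $G$ be a finite group and let $V$ be a faithful irreducible $FG$-module. For a prime $r$, an $r$-group $R$ is said to be of symplectic type if either $r$ is odd and $R$ is extraspecial of exponent $r$, or $r=2$, $R/Z(R)$ is elementary abelian, $R'$ has order $2$, $R$ has exponent $4$, and $Z(R)$ has order $2$ or $4$. Suppose that $G$ has a normal $r$-subgroup $R$ of symplectic type with $|R/Z(R)|=r^{2a}$ for some prime $r$ and integer $a$, that $R$ acts absolutely irreducibly on $V$, that $\dim_F V=r^{a}$, and that $O_p(G)=1$ (that is, $G$ has no non-trivial normal $p$-subgroup). Suppose also that $R$ is the unique subgroup of $G$ that is minimal among the normal subgroups of $G$ not contained in $Z(G)$. Then for every non-identity element $x$ of $G$ the subspace $C_V(x)=\{v\in V : xv=v\}$ satisfies $$\dim_F C_V(x)\le \frac{r+1}{2r}\cdot r^{a}.$$ -/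

import Mathlib

open scoped TensorProduct

universe u

/-- `H` is an elementary abelian `r`-group: abelian, and every element satisfies `h ^ r = 1`.
(Used only for a prime `r`; the trivial group is allowed.) -/
def IsElementaryAbelianGroup (r : ℕ) (H : Type*) [Group H] : Prop :=
  (∀ x y : H, x * y = y * x) ∧ ∀ x : H, x ^ r = 1

/-- `P` is an extraspecial `r`-group: an `r`-group whose centre has order `r` and whose quotient by
the centre is a nontrivial elementary abelian `r`-group. -/
def IsExtraspecialGroup (r : ℕ) (P : Type*) [Group P] : Prop :=
  IsPGroup r P ∧ Nat.card (Subgroup.center P) = r ∧ Nontrivial (P ⧸ Subgroup.center P) ∧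
    IsElementaryAbelianGroup r (P ⧸ Subgroup.center P)

/-- `P` is an `r`-group of symplectic type: either `r` is odd and `P` is extraspecial of exponent
`r`, or `r = 2`, `P / Z(P)` is elementary abelian, the derived subgroup of `P` has order `2`,
`P` has exponent `4`, and `Z(P)` has order `2` or `4`. -/
def IsSymplecticType (r : ℕ) (P : Type*) [Group P] : Prop :=
  IsPGroup r P ∧
    ((Odd r ∧ IsExtraspecialGroup r P ∧ Monoid.exponent P = r) ∨
      (r = 2 ∧ IsElementaryAbelianGroup 2 (P ⧸ Subgroup.center P) ∧
        Nat.card (commutator P) = 2 ∧ Monoid.exponent P = 4 ∧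
        (Nat.card (Subgroup.center P) = 2 ∨ Nat.card (Subgroup.center P) = 4)))

/-- `O_p(G)`: the subgroup generated by all normal `p`-subgroups of `G`
(for finite `G`, the largest normal `p`-subgroup). -/
def pCoreSubgroup (p : ℕ) (G : Type*) [Group G] : Subgroup G :=
  sSup {N : Subgroup G | N.Normal ∧ IsPGroup p N}

/-- `N` is minimal among the normal subgroups of `G` that are not contained in the centre. -/
def IsMinimalNoncentralNormal {G : Type*} [Group G] (N : Subgroup G) : Prop :=
  Minimal (fun M : Subgroup G => M.Normal ∧ ¬ M ≤ Subgroup.center G) N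

/-- The representation `K ⊗ V` obtained from `V` by extension of scalars from `F` to `K`. -/
noncomputable def scalarExtension {F G V : Type*} [Field F] [Group G] [AddCommGroup V] [Module F V]
    (K : Type*) [Field K] [Algebra F K] (ρ : Representation F G V) :
    Representation K G (K ⊗[F] V) where
  toFun g := (ρ g).baseChange K
  map_one' := by
    rw [map_one, Module.End.one_eq_id, LinearMap.baseChange_id, Module.End.one_eq_id]
  map_mul' g h := by
    rw [map_mul, Module.End.mul_eq_comp, LinearMap.baseChange_comp, Module.End.mul_eq_comp]

/-- A representation over `F` is absolutely irreducible if it stays irreducible after every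
extension of the field of scalars. -/
def IsAbsolutelyIrreducible {F : Type u} {G V : Type*} [Field F] [Group G] [AddCommGroup V]
    [Module F V] (ρ : Representation F G V) : Prop :=
  ∀ (K : Type u) [Field K] [Algebra F K], (scalarExtension K ρ).IsIrreducible

/-- `C_V(x)`: the subspace of vectors fixed by `x`. -/
def fixedSpace {F G V : Type*} [Field F] [Group G] [AddCommGroup V] [Module F V]
    (ρ : Representation F G V) (x : G) : Submodule F V where
  carrier := {v | ρ x v = v}
  add_mem' := by
    intro v w hv hw
    simp only [Set.mem_ofPred_eq] at hv hw ⊢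
    rw [map_add, hv, hw]
  zero_mem' := by simp
  smul_mem' := by
    intro c v hv
    simp only [Set.mem_ofPred_eq] at hv ⊢
    rw [map_smul, hv]

/-! If `x` centralizes `R`, Schur's lemma makes `x` a scalar, and by faithfulness a scalar other
than 1, so it fixes only 0. Otherwise some `y` in `R` gives a commutator `g = [x, y] ≠ 1`, which
lies in `R` by normality. Since C_V(x) ∩ y C_V(x) ⊆ C_V(g), one gets 2 dim C_V(x) ≤ dim V + dim
C_V(g) (`two_mul_finrank_fixedSpace_le`). Non-identity elements of `R` satisfy dim C_V(g) ≤ dim V /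
r (`IsSymplecticType.mul_finrank_fixedSpace_le`), whence the factor (1 + 1/r)/2. -/

section Irreducible

variable {F : Type u} {G V : Type*} [Field F] [Group G] [AddCommGroup V] [Module F V]

theorem lid_scalarExtension_apply (ρ : Representation F G V) (g : G) (w : F ⊗[F] V) :
    TensorProduct.lid F V (scalarExtension F ρ g w) = ρ g (TensorProduct.lid F V w) := by
  change TensorProduct.lid F V ((ρ g).baseChange F w) = _
  induction w with
  | zero => simp
  | tmul a v => simp
  | add x y hx hy => simp only [map_add, hx, hy]

/-- This is the case `K = F` of the definition, carried along F ⊗ V ≅ V. -/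
theorem IsAbsolutelyIrreducible.eq_bot_or_eq_top {ρ : Representation F G V}
    (h : IsAbsolutelyIrreducible ρ) (U : Submodule F V) (hU : ∀ g, ∀ v ∈ U, ρ g v ∈ U) :
    U = ⊥ ∨ U = ⊤ := by
  have := h F
  let S : Subrepresentation (scalarExtension F ρ) :=
    { toSubmodule := U.comap (TensorProduct.lid F V).toLinearMap
      apply_mem_toSubmodule := fun g w hw => by
        rw [Submodule.mem_comap, LinearEquiv.coe_coe] at hw ⊢
        rw [lid_scalarExtension_apply]
        exact hU g _ hw }
  have key : ∀ v : V, (TensorProduct.lid F V).symm v ∈ S.toSubmodule ↔ v ∈ U := fun v => by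
    simp only [S, Submodule.mem_comap, LinearEquiv.coe_coe, LinearEquiv.apply_symm_apply]
  rcases IsSimpleOrder.eq_bot_or_eq_top S with hS | hS
  · left
    rw [Submodule.eq_bot_iff]
    intro v hv
    have hv' := (key v).2 hv
    rw [hS] at hv'
    have h0 : (TensorProduct.lid F V).symm v = 0 := hv'
    simpa using h0
  · right
    rw [Submodule.eq_top_iff']
    intro v
    rw [← key v, hS]
    exact Submodule.mem_top (R := F)

/-- Schur's lemma for absolutely irreducible representations. -/
theorem IsAbsolutelyIrreducible.exists_eq_smul [IsAlgClosed F] [FiniteDimensional F V]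
    [Nontrivial V] {ρ : Representation F G V} (h : IsAbsolutelyIrreducible ρ)
    (T : Module.End F V) (hT : ∀ g v, T (ρ g v) = ρ g (T v)) : ∃ c : F, ∀ v, T v = c • v := by
  obtain ⟨c, hc⟩ := Module.End.exists_eigenvalue T
  refine ⟨c, fun v => ?_⟩
  have htop : T.eigenspace c = ⊤ := by
    refine (h.eq_bot_or_eq_top (T.eigenspace c) fun g v hv => ?_).resolve_left hc
    rw [Module.End.mem_eigenspace_iff] at hv ⊢
    rw [hT, hv, map_smul]
  rw [← Module.End.mem_eigenspace_iff, htop]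
  exact Submodule.mem_top

end Irreducible

section FixedSpace

variable {F G V : Type*} [Field F] [Group G] [AddCommGroup V] [Module F V]

theorem mem_fixedSpace {ρ : Representation F G V} {x : G} {v : V} :
    v ∈ fixedSpace ρ x ↔ ρ x v = v := Iff.rfl

theorem fixedSpace_eq_bot_of_smul {ρ : Representation F G V} (hρ : Function.Injective ρ)
    {x : G} (hx : x ≠ 1) {c : F} (hc : ∀ v, ρ x v = c • v) : fixedSpace ρ x = ⊥ := by
  rw [Submodule.eq_bot_iff]
  intro v hv
  by_contra hv0
  rw [mem_fixedSpace, hc] at hv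
  have hc1 : c = 1 := by
    have : (c - 1) • v = 0 := by rw [sub_smul, hv, one_smul, sub_self]
    exact sub_eq_zero.1 ((smul_eq_zero.1 this).resolve_right hv0)
  refine hx (hρ (LinearMap.ext fun w => ?_))
  rw [hc, hc1, one_smul, map_one, Module.End.one_apply]

theorem two_mul_finrank_fixedSpace_le [FiniteDimensional F V] (ρ : Representation F G V)
    (x y : G) : 2 * Module.finrank F (fixedSpace ρ x) ≤
      Module.finrank F V + Module.finrank F (fixedSpace ρ (x * y * x⁻¹ * y⁻¹)) := by
  have hconj : (fixedSpace ρ x).map (ρ y) ≤ fixedSpace ρ (y * x * y⁻¹) := by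
    rintro _ ⟨v, hv, rfl⟩
    rw [mem_fixedSpace, ← Module.End.mul_apply, ← map_mul, inv_mul_cancel_right, map_mul,
      Module.End.mul_apply, mem_fixedSpace.1 hv]
  have hdim : Module.finrank F ((fixedSpace ρ x).map (ρ y)) =
      Module.finrank F (fixedSpace ρ x) :=
    (Submodule.equivMapOfInjective _ (ρ.apply_bijective y).1 _).finrank_eq.symm
  have hinf : fixedSpace ρ x ⊓ (fixedSpace ρ x).map (ρ y) ≤
      fixedSpace ρ (x * y * x⁻¹ * y⁻¹) := by
    rintro v ⟨hv, hv'⟩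
    -- `v` is fixed by `y * x * y⁻¹`, hence by its inverse.
    have h1 : ρ (y * x⁻¹ * y⁻¹) v = v := by
      conv_lhs => rw [← mem_fixedSpace.1 (hconj hv')]
      rw [← Module.End.mul_apply, ← map_mul]
      simp [mul_assoc]
    rw [mem_fixedSpace, show x * y * x⁻¹ * y⁻¹ = x * (y * x⁻¹ * y⁻¹) by group, map_mul,
      Module.End.mul_apply, h1]
    exact hv
  have h1 := Submodule.finrank_sup_add_finrank_inf_eq (fixedSpace ρ x)
    ((fixedSpace ρ x).map (ρ y))
  have h2 := Submodule.finrank_le (fixedSpace ρ x ⊔ (fixedSpace ρ x).map (ρ y))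
  have h3 := Submodule.finrank_mono hinf
  omega

end FixedSpace

theorem iSupIndep.card_mul_le_finrank {F V : Type*} [Field F] [AddCommGroup V] [Module F V]
    [FiniteDimensional F V] {ι : Type} [Fintype ι] [DecidableEq ι] {S : ι → Submodule F V}
    (hS : iSupIndep S) {d : ℕ} (hd : ∀ i, d ≤ Module.finrank F (S i)) :
    Fintype.card ι * d ≤ Module.finrank F V := by
  have hle := LinearMap.finrank_le_finrank_of_injective
    (f := DirectSum.coeLinearMap S) hS.dfinsupp_lsum_injective
  rw [Module.finrank_directSum] at hle
  refine le_trans ?_ hle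
  rw [← smul_eq_mul, ← Finset.card_univ]
  exact Finset.card_nsmul_le_sum _ _ _ fun i _ => hd i

section Symplectic

variable {F : Type u} {R V : Type*} [Field F] [Group R] [AddCommGroup V] [Module F V]

theorem IsSymplecticType.commutator_mem_center {r : ℕ} (h : IsSymplecticType r R) (x y : R) :
    x * y * x⁻¹ * y⁻¹ ∈ Subgroup.center R := by
  have hab : ∀ a b : R ⧸ Subgroup.center R, a * b = b * a := by
    rcases h.2 with ⟨-, he, -⟩ | ⟨-, he, -⟩
    · exact he.2.2.2.1
    · exact he.1
  rw [← QuotientGroup.eq_one_iff]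
  simp only [QuotientGroup.mk_mul, QuotientGroup.mk_inv]
  rw [hab (x : R ⧸ Subgroup.center R) y]
  group

/-- The powers `h ^ i` carry C_V(g) injectively into the `c ^ i`-eigenspaces of `g`. By faithfulness
`c` has the same order as `z`, a multiple of `r`, so for `i < r` these eigenvalues are distinct and
the eigenspaces independent. -/
theorem mul_finrank_fixedSpace_le_of_commutator_smul [FiniteDimensional F V] [Nontrivial V]
    {r : ℕ} [Fact r.Prime] (hR : IsPGroup r R) {ρ : Representation F R V}
    (hρ : Function.Injective ρ) {g h z : R} (hz : z ≠ 1) (hgh : g * h = z * (h * g))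
    {c : F} (hc : ∀ v, ρ z v = c • v) :
    r * Module.finrank F (fixedSpace ρ g) ≤ Module.finrank F V := by
  have hzpow : ∀ (i : ℕ) (v : V), ρ (z ^ i) v = c ^ i • v := by
    intro i v
    induction i with
    | zero => simp
    | succ i ih => rw [pow_succ', map_mul, Module.End.mul_apply, ih, hc, smul_smul, pow_succ']
  have horder : orderOf c = orderOf z := by
    refine orderOf_eq_orderOf_iff.2 fun i => ⟨fun hi => hρ (LinearMap.ext fun v => ?_), fun hi => ?_⟩
    · rw [hzpow, hi, one_smul, map_one, Module.End.one_apply]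
    · obtain ⟨v, hv⟩ := exists_ne (0 : V)
      have h1 := hzpow i v
      rw [hi, map_one, Module.End.one_apply] at h1
      have : (c ^ i - 1) • v = 0 := by rw [sub_smul, ← h1, one_smul, sub_self]
      exact sub_eq_zero.1 ((smul_eq_zero.1 this).resolve_right hv)
  have hle : r ≤ orderOf c := by
    rw [horder]
    exact Nat.le_of_dvd (hR.isOfFinOrder (Fact.out : r.Prime).ne_zero z).orderOf_pos
      (hR.dvd_orderOf hz)
  have hinj : Function.Injective fun i : Fin r => c ^ (i : ℕ) := fun i j hij =>
    Fin.ext (pow_injOn_Iio_orderOf (i.2.trans_le hle) (j.2.trans_le hle) hij)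
  have heigen : ∀ (i : ℕ) (v : V), ρ g v = v → ρ g (ρ (h ^ i) v) = c ^ i • ρ (h ^ i) v := by
    intro i v hv
    induction i with
    | zero => simpa using hv
    | succ i ih =>
      rw [pow_succ', map_mul, Module.End.mul_apply, ← Module.End.mul_apply, ← map_mul, hgh,
        map_mul, Module.End.mul_apply, hc, map_mul, Module.End.mul_apply, ih, map_smul, smul_smul, pow_succ']
  have hind : iSupIndep fun i : Fin r => Module.End.eigenspace (ρ g) (c ^ (i : ℕ)) :=
    (Module.End.eigenspaces_iSupIndep (ρ g)).comp hinj
  have := hind.card_mul_le_finrank (d := Module.finrank F (fixedSpace ρ g)) fun i => by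
    rw [(Submodule.equivMapOfInjective _ (ρ.apply_bijective (h ^ (i : ℕ))).1 _).finrank_eq]
    apply Submodule.finrank_mono
    rintro _ ⟨v, hv, rfl⟩
    rw [Module.End.mem_eigenspace_iff]
    exact heigen i v hv
  rwa [Fintype.card_fin] at this

/-- Non-identity elements of an absolutely irreducible group of symplectic type fix a subspace of
codimension at least `(1 - 1 / r) * dim V`. -/
theorem IsSymplecticType.mul_finrank_fixedSpace_le [IsAlgClosed F] [FiniteDimensional F V]
    [Nontrivial V] {r : ℕ} [Fact r.Prime] (hR : IsSymplecticType r R) {ρ : Representation F R V}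
    (hρ : Function.Injective ρ) (hirr : IsAbsolutelyIrreducible ρ) {g : R} (hg : g ≠ 1) :
    r * Module.finrank F (fixedSpace ρ g) ≤ Module.finrank F V := by
  have hscalar : ∀ z ∈ Subgroup.center R, ∃ c : F, ∀ v, ρ z v = c • v := fun z hz =>
    hirr.exists_eq_smul (ρ z) fun h v => by
      rw [← Module.End.mul_apply, ← Module.End.mul_apply, ← map_mul, ← map_mul,
        Subgroup.mem_center_iff.1 hz h]
  by_cases hcen : g ∈ Subgroup.center R
  · obtain ⟨c, hc⟩ := hscalar g hcen
    rw [fixedSpace_eq_bot_of_smul hρ hg hc, finrank_bot, mul_zero]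
    exact Nat.zero_le _
  -- Some `h` does not commute with `g`; their commutator is central because R/Z(R) is abelian, so
  -- it acts as a scalar.
  · rw [Subgroup.mem_center_iff, not_forall] at hcen
    obtain ⟨h, hh⟩ := hcen
    obtain ⟨c, hc⟩ := hscalar _ (hR.commutator_mem_center g h)
    refine mul_finrank_fixedSpace_le_of_commutator_smul hR.1 hρ (h := h)
      (z := g * h * g⁻¹ * h⁻¹) (fun hz => hh ?_) (by group) hc
    rw [mul_inv_eq_one, mul_inv_eq_iff_eq_mul] at hz
    exact hz.symm

end Symplectic

theorem theorem2 {F G V : Type*} [Field F] [IsAlgClosed F] (p : ℕ) [Fact p.Prime] [CharP F p]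
    [Group G] [Finite G] [AddCommGroup V] [Module F V]
    (ρ : Representation F G V) (hfaithful : Function.Injective ρ) (hirr : ρ.IsIrreducible)
    (r a : ℕ) (hr : r.Prime) (R : Subgroup G) (hRnormal : R.Normal)
    (hRtype : IsSymplecticType r R)
    (hRcard : Nat.card (R ⧸ Subgroup.center R) = r ^ (2 * a))
    (hRirr : IsAbsolutelyIrreducible (ρ.comp R.subtype))
    (hdim : Module.finrank F V = r ^ a)
    (hcore : pCoreSubgroup p G = ⊥)
    (hRunique : ∀ N : Subgroup G, IsMinimalNoncentralNormal N ↔ N = R)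
    (x : G) (hx : x ≠ 1) :
    (Module.finrank F (fixedSpace ρ x) : ℝ) ≤ (((r : ℝ) + 1) / (2 * (r : ℝ))) * (r : ℝ) ^ a := by
  have : Fact r.Prime := ⟨hr⟩
  have hpos : 0 < Module.finrank F V := hdim ▸ pow_pos hr.pos a
  have : FiniteDimensional F V := Module.finite_of_finrank_pos hpos
  have : Nontrivial V := Module.nontrivial_of_finrank_pos hpos
  suffices h : 2 * r * Module.finrank F (fixedSpace ρ x) ≤ (r + 1) * Module.finrank F V by
    rw [hdim] at h
    have hr0 : (0 : ℝ) < 2 * r := by exact_mod_cast Nat.mul_pos two_pos hr.pos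
    rw [div_mul_eq_mul_div, le_div_iff₀ hr0, mul_comm]
    exact_mod_cast h
  by_cases hcomm : ∀ y : R, x * y = y * x
  · obtain ⟨c, hc⟩ := hRirr.exists_eq_smul (ρ x) fun y v => by
      change ρ x (ρ y v) = ρ y (ρ x v)
      rw [← Module.End.mul_apply, ← Module.End.mul_apply, ← map_mul, ← map_mul, hcomm y]
    rw [fixedSpace_eq_bot_of_smul hfaithful hx hc, finrank_bot, mul_zero]
    exact Nat.zero_le _
  · rw [not_forall] at hcomm
    obtain ⟨y, hy⟩ := hcomm
    have hmem : x * y * x⁻¹ * (y : G)⁻¹ ∈ R :=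
      R.mul_mem (hRnormal.conj_mem y y.2 x) (R.inv_mem y.2)
    have hne : (⟨_, hmem⟩ : R) ≠ 1 := fun h => hy <| by
      have h' : x * y * x⁻¹ * (y : G)⁻¹ = 1 := congrArg Subtype.val h
      rwa [mul_inv_eq_one, mul_inv_eq_iff_eq_mul] at h'
    have h1 : r * Module.finrank F (fixedSpace ρ (x * y * x⁻¹ * (y : G)⁻¹)) ≤
        Module.finrank F V := by
      have hinj : Function.Injective (ρ.comp R.subtype) :=
        hfaithful.comp R.subtype_injective
      have := hRtype.mul_finrank_fixedSpace_le hinj hRirr hne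
      exact this
    -- Multiplying by `r` lets `h1` bound the commutator term by one more copy of dim V, giving the
    -- coefficient `r + 1`.
    have h2 := Nat.mul_le_mul_left r (two_mul_finrank_fixedSpace_le ρ x (y : G))
    linarith
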